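/- Let $I\subset\mathbb R$ be an open interval and let $f\in BV_{\mathrm{loc}}(I)$, i.e. $f\in L^1_{\mathrm{loc}}(I)$ and its distributional derivative $Df$ is a signed Radon measure on $I$; let $|Df|$ be its total variation measure and $\operatorname{spt}(|Df|)\subset I$ the support of $|Df|$. For a bounded open interval $Q$ of length $\ell(Q)>0$ and $u$ integrable on $Q$, put $$\mathrm{Osc}(u,Q)=\frac1{\ell(Q)}\int_Q\Big|u-\frac1{\ell(Q)}\int_Q u\Big|\,dy .$$ * Local Poincaré constant: for $x\in\operatorname{spt}(|Df|)$, $$p^1_f(x)=\lim_{\varepsilon\to0^+}\ \sup\Big\{\frac{\mathrm{Osc}(f,Q)}{|Df|(Q)}:\ Q\subset I\text{ open interval},\ x\in Q,\ \ell(Q)\le\varepsilon\Big\},$$ and $p^1_f(x)=0$ for $x\in I\setminus\operatorname{spt}(|Df|)$. * Tangents: let $Q_0=(-\tfrac12,\tfrac12)$. For an open interval $Q\subset I$ with center $c$, $0<|Df|(Q)<\infty$ and $f\in L^1(Q)$, and for an orientation $s\in\{1,-1\}$, let $$f_{Q,s}(y)=\frac1{|Df|(Q)}\Big(f\big(c+s\,\ell(Q)\,y\big)-\frac1{\ell(Q)}\int_Q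 f\Big),\qquad y\in Q_0 .$$ For $x\in\operatorname{spt}(|Df|)$, $\mathrm{Tan}^1(f,x)$ is the set of all limits in $L^1(Q_0)$ of sequences $(f_{Q_j,s_j})_j$ with $Q_j\subset I$, $x\in Q_j$ for all $j$ and $\ell(Q_j)\to0$; for $x\notin\operatorname{spt}(|Df|)$, $\mathrm{Tan}^1(f,x)=\emptyset$. * BMO seminorm: $\|u\|_{\mathrm{BMO}(Q_0)}=\sup\{\mathrm{Osc}(u,Q):\ Q\subset Q_0\text{ a nonempty open interval}\}$. Then, for $|Df|$-almost every $x\in I$, $$p^1_f(x)=\sup_{u\in\mathrm{Tan}^1(f,x)}\|u\|_{\mathrm{BMO}((-\frac12,\frac12))}.$$ -/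

import Mathlib

open MeasureTheory Set Filter Topology
open scoped ENNReal

namespace BVLine

/-- `Df = σ |Df|` on the open set `I` in the sense of distributions, with `|Df| = μ`: the positive
measure `μ` is carried by `I` and finite on the compact subsets of `I`, the density `σ` takes the
values `±1` at `μ`-almost every point, and
`∫_I f φ' = - ∫ φ σ dμ` for every smooth `φ` with compact support in `I`.
This is the polar form of "the distributional derivative of `f` on `I` is a Radon measure",
and then `μ` is the total variation measure of `Df`. -/
structure IsPolarDeriv (I : Set ℝ) (f : ℝ → ℝ) (μ : Measure ℝ) (σ : ℝ → ℝ) : Prop where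
  compl_null : μ Iᶜ = 0
  compact_lt_top : ∀ K : Set ℝ, IsCompact K → K ⊆ I → μ K < ∞
  measurable_density : Measurable σ
  abs_density : ∀ᵐ x ∂μ, |σ x| = 1
  integral_eq : ∀ φ : ℝ → ℝ, ContDiff ℝ (⊤ : ℕ∞) φ → HasCompactSupport φ → tsupport φ ⊆ I →
    ∫ x in I, f x * deriv φ x = - ∫ x, φ x * σ x ∂μ

/-- `f ∈ BV_loc(I)`: `f` is locally integrable on `I` and its distributional derivative on `I` is a
(signed) Radon measure. The values of `f` outside `I` play no role. -/
def BVLoc (I : Set ℝ) (f : ℝ → ℝ) : Prop :=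
  LocallyIntegrableOn f I volume ∧ ∃ (μ : Measure ℝ) (σ : ℝ → ℝ), IsPolarDeriv I f μ σ

open Classical in
/-- The total variation measure `|Df|` of `f ∈ BV_loc(I)`, extended by zero outside `I`
(and `0` by convention if the distributional derivative is not a Radon measure). It is the only
possible choice, see `variation_eq`. -/
noncomputable def variation (I : Set ℝ) (f : ℝ → ℝ) : Measure ℝ :=
  if h : ∃ (μ : Measure ℝ) (σ : ℝ → ℝ), IsPolarDeriv I f μ σ then h.choose else 0

/-- The support of `|Df|`, a relatively closed subset of `I`. -/
noncomputable def spt (I : Set ℝ) (f : ℝ → ℝ) : Set ℝ := (variation I f).support ∩ I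

/-- The one-dimensional open cube with center `c` and sidelength `l`. -/
def cube (c l : ℝ) : Set ℝ := Ioo (c - l / 2) (c + l / 2)

/-- The unit cube `Q₀ = (-1/2, 1/2)`. -/
def unitCube : Set ℝ := Ioo (-1 / 2) (1 / 2)

/-- Mean oscillation `⨍_Q |f - ⨍_Q f|`. -/
noncomputable def osc (f : ℝ → ℝ) (Q : Set ℝ) : ℝ≥0∞ :=
  ⨍⁻ y in Q, ‖f y - ⨍ z in Q, f z‖ₑ ∂volume

/-- The Poincaré quotient `P_f(Q) = Osc(f,Q) / |Df|(Q)`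
(in dimension one the factor `ℓ(Q)^(n-1)` is `1`). -/
noncomputable def poincareQuotient (I : Set ℝ) (f : ℝ → ℝ) (Q : Set ℝ) : ℝ≥0∞ :=
  osc f Q / variation I f Q

/-- `P_f^1(x,ε)`: the supremum of `P_f(Q)` over the open intervals `Q ⊆ I` with `x ∈ Q` and
sidelength at most `ε`. -/
noncomputable def poincareSup (I : Set ℝ) (f : ℝ → ℝ) (x ε : ℝ) : ℝ≥0∞ :=
  ⨆ (c : ℝ) (l : ℝ) (_ : 0 < l ∧ l ≤ ε ∧ cube c l ⊆ I ∧ x ∈ cube c l),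
    poincareQuotient I f (cube c l)

open Classical in
/-- The local Poincaré constant `p_f^1(x)`: the limit of `P_f^1(x,ε)` as `ε → 0⁺` on the support of
`|Df|` (this limit exists, see `tendsto_poincareSup`), and `0` outside. -/
noncomputable def poincareConst (I : Set ℝ) (f : ℝ → ℝ) (x : ℝ) : ℝ≥0∞ :=
  if x ∈ spt I f then limUnder (𝓝[>] (0 : ℝ)) (fun ε => poincareSup I f x ε) else 0

/-- The rescaling `f_Q` of `f` on the oriented cube `Q` with center `c`, sidelength `l` and
orientation `s = ±1`, for which `T_Q y = c + s l y`. -/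
noncomputable def rescale (I : Set ℝ) (f : ℝ → ℝ) (c l : ℝ) (s : ℤˣ) (y : ℝ) : ℝ :=
  (f (c + ((s : ℤ) : ℝ) * l * y) - ⨍ z in cube c l, f z) / (variation I f (cube c l)).toReal

/-- `u ∈ Tan^1(f,x)`: `x` lies in the support of `|Df|` and `u` is the `L^1(Q₀)`-limit of a sequence
of rescalings of `f` on oriented cubes `Q_j ⊆ I` with `x ∈ Q_j` and `ℓ(Q_j) → 0`.
(Elements of `L^1(Q₀)` are represented by functions that are integrable on `Q₀`.) -/
def tan (I : Set ℝ) (f : ℝ → ℝ) (x : ℝ) : Set (ℝ → ℝ) :=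
  {u | x ∈ spt I f ∧ IntegrableOn u unitCube volume ∧
    ∃ (c l : ℕ → ℝ) (s : ℕ → ℤˣ),
      (∀ j, 0 < l j ∧ cube (c j) (l j) ⊆ I ∧ x ∈ cube (c j) (l j)) ∧
      Tendsto l atTop (𝓝 0) ∧
      Tendsto (fun j => ∫⁻ y in unitCube, ‖rescale I f (c j) (l j) (s j) y - u y‖ₑ)
        atTop (𝓝 0)}

/-- The seminorm `‖u‖_BMO(U)`, the supremum of the mean oscillations of `u` over the open intervals
contained in `U`. -/
noncomputable def bmo (u : ℝ → ℝ) (U : Set ℝ) : ℝ≥0∞ :=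
  ⨆ (c : ℝ) (l : ℝ) (_ : 0 < l ∧ cube c l ⊆ U), osc u (cube c l)

theorem poincareSup_mono (I : Set ℝ) (f : ℝ → ℝ) (x : ℝ) : Monotone (poincareSup I f x) := by
  intro a b hab
  refine iSup_mono fun c => iSup_mono fun l => iSup_mono' fun h => ?_
  exact ⟨⟨h.1, h.2.1.trans hab, h.2.2⟩, le_rfl⟩

/-- The limit in the definition of the local Poincaré constant exists. -/
theorem tendsto_poincareSup (I : Set ℝ) (f : ℝ → ℝ) (x : ℝ) (hx : x ∈ spt I f) :
    Tendsto (poincareSup I f x) (𝓝[>] 0) (𝓝 (poincareConst I f x)) := by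
  rw [poincareConst, if_pos hx]
  exact tendsto_nhds_limUnder ⟨_, (poincareSup_mono I f x).tendsto_nhdsGT 0⟩

theorem IsPolarDeriv.sigmaFinite {I : Set ℝ} (hI : IsOpen I) {f σ : ℝ → ℝ} {μ : Measure ℝ}
    (h : IsPolarDeriv I f μ σ) : SigmaFinite μ := by
  obtain ⟨F, hF, hFI, hU, hmono⟩ := hI.exists_iUnion_isClosed
  refine ⟨⟨⟨fun n => (F n ∩ Metric.closedBall 0 n) ∪ Iᶜ, fun _ => trivial, fun n => ?_, ?_⟩⟩⟩
  · refine (measure_union_le _ _).trans_lt ?_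
    rw [h.compl_null, add_zero]
    exact h.compact_lt_top _ ((isCompact_closedBall 0 _).inter_left (hF n))
      (inter_subset_left.trans (hFI n))
  · refine eq_univ_of_forall fun x => ?_
    by_cases hx : x ∈ I
    · rw [← hU] at hx
      obtain ⟨m, hm⟩ := mem_iUnion.1 hx
      obtain ⟨k, hk⟩ := exists_nat_ge |x|
      refine mem_iUnion.2 ⟨max m k, Or.inl ⟨hmono (le_max_left m k) hm, ?_⟩⟩
      rw [mem_closedBall_zero_iff, Real.norm_eq_abs]
      exact hk.trans (by exact_mod_cast le_max_right m k)
    · exact mem_iUnion.2 ⟨0, Or.inr hx⟩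

/-- The total variation measure is uniquely determined. -/
theorem IsPolarDeriv.unique {I : Set ℝ} (hI : IsOpen I) {f σ s : ℝ → ℝ} {μ ν : Measure ℝ}
    (hμ : IsPolarDeriv I f μ σ) (hν : IsPolarDeriv I f ν s) : μ = ν := by
  have := hμ.sigmaFinite hI
  have := hν.sigmaFinite hI
  set ρ := μ + ν with hρ
  have hμρ : μ ≪ ρ := Measure.AbsolutelyContinuous.rfl.add_right ν
  have hνρ : ν ≪ ρ := by rw [hρ, add_comm]; exact Measure.AbsolutelyContinuous.rfl.add_right μ
  have loc : ∀ (τ : ℝ → ℝ) (α : Measure ℝ) [SigmaFinite α], α ≪ ρ → IsPolarDeriv I f α τ →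
      LocallyIntegrableOn (fun x => (α.rnDeriv ρ x).toReal • τ x) I ρ := by
    intro τ α _ hα h
    rw [locallyIntegrableOn_iff hI.isLocallyClosed]
    intro K hKI hK
    have h1 : IntegrableOn τ K α := by
      refine Measure.integrableOn_of_bounded (M := 1) (h.compact_lt_top K hK hKI).ne
        h.measurable_density.aestronglyMeasurable ?_
      filter_upwards [ae_restrict_of_ae h.abs_density] with x hx
      simp [hx]
    rw [← integrable_indicator_iff hK.measurableSet] at h1 ⊢
    rw [← integrable_rnDeriv_smul_iff hα] at h1
    refine h1.congr (Filter.Eventually.of_forall fun x => ?_)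
    by_cases hx : x ∈ K <;> simp [hx]
  have int : ∀ (τ : ℝ → ℝ) (α : Measure ℝ) [SigmaFinite α], α ≪ ρ → ∀ g : ℝ → ℝ,
      ∫ x, g x • ((α.rnDeriv ρ x).toReal • τ x) ∂ρ = ∫ x, g x * τ x ∂α := by
    intro τ α _ hα g
    rw [← integral_rnDeriv_smul hα]
    congr 1 with x
    simp only [smul_eq_mul]
    ring
  have key := hI.ae_eq_zero_of_integral_contDiff_smul_eq_zero
    ((loc σ μ hμρ hμ).sub (loc s ν hνρ hν)) (by
      intro g hg hgc hgI
      have e : ∀ (h : ℝ → ℝ), LocallyIntegrableOn h I ρ → Integrable (fun x => g x • h x) ρ :=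
        fun h hh => by
          have h1 : IntegrableOn h (tsupport g) ρ := hh.integrableOn_compact_subset hgI hgc
          have h2 := h1.continuousOn_smul hg.continuous.continuousOn hgc
          rwa [integrableOn_iff_integrable_of_support_subset] at h2
          intro x hx
          refine subset_tsupport g ?_
          intro h0
          exact hx (by simp [h0])
      have h1 := hμ.integral_eq g hg hgc hgI
      have h2 := hν.integral_eq g hg hgc hgI
      simp only [Pi.sub_apply, smul_sub]
      rw [integral_sub (e _ (loc σ μ hμρ hμ)) (e _ (loc s ν hνρ hν)), int σ μ hμρ, int s ν hνρ]
      linarith)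
  have ac : ∀ (τ : ℝ → ℝ) (α : Measure ℝ) [SigmaFinite α], α ≪ ρ → IsPolarDeriv I f α τ →
      ∀ᵐ x ∂ρ, α.rnDeriv ρ x = 0 ∨ (x ∈ I ∧ |τ x| = 1) := by
    intro τ α _ hα h
    have h1 : ∀ᵐ x ∂α, x ∈ I ∧ |τ x| = 1 := by
      have h2 : ∀ᵐ x ∂α, x ∈ I := by
        rw [ae_iff]
        exact h.compl_null
      exact h2.and h.abs_density
    rw [← Measure.withDensity_rnDeriv_eq α ρ hα,
      ae_withDensity_iff (Measure.measurable_rnDeriv α ρ)] at h1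
    filter_upwards [h1] with x hx
    by_cases h0 : α.rnDeriv ρ x = 0
    · exact Or.inl h0
    · exact Or.inr (hx h0)
  have fin : μ.rnDeriv ρ =ᵐ[ρ] ν.rnDeriv ρ := by
    filter_upwards [key, ac σ μ hμρ hμ, ac s ν hνρ hν, μ.rnDeriv_lt_top ρ, ν.rnDeriv_lt_top ρ]
      with x hk ha hb hc hd
    have main : x ∈ I → |(μ.rnDeriv ρ x).toReal| * |σ x| = |(ν.rnDeriv ρ x).toReal| * |s x| := by
      intro hx
      have := hk hx
      simp only [Pi.sub_apply, smul_eq_mul, sub_eq_zero] at this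
      rw [← abs_mul, ← abs_mul, this]
    rw [← ENNReal.toReal_eq_toReal_iff' hc.ne hd.ne]
    rcases ha with ha | ⟨ha, ha'⟩ <;> rcases hb with hb | ⟨hb, hb'⟩
    · rw [ha, hb]
    · have := main hb
      rw [ha, hb'] at this
      rw [ha]
      simpa using this
    · have := main ha
      rw [hb, ha'] at this
      rw [hb]
      simpa using this
    · have := main ha
      rw [ha', hb'] at this
      simpa using this
  rw [← Measure.withDensity_rnDeriv_eq μ ρ hμρ, ← Measure.withDensity_rnDeriv_eq ν ρ hνρ,
    withDensity_congr_ae fin]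

/-- `variation I f` is the measure `|Df|` of every polar representation `Df = σ |Df|`. -/
theorem variation_eq {I : Set ℝ} (hI : IsOpen I) {f σ : ℝ → ℝ} {μ : Measure ℝ}
    (h : IsPolarDeriv I f μ σ) : variation I f = μ := by
  have h' : ∃ (μ : Measure ℝ) (σ : ℝ → ℝ), IsPolarDeriv I f μ σ := ⟨μ, σ, h⟩
  rw [variation, dif_pos h']
  exact h'.choose_spec.choose_spec.unique hI h

end BVLine

/-! Write `μ = |Df|`. On an interval `Q` whose closure lies in `I`, `f` is a.e. a constant plus the
primitive `t ↦ Df((a,t])`, whose values differ by at most `μ(Q)`; hence `Osc(f,Q) ≤ μ(Q)`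
(`IsPolarDeriv.osc_le`). Both inequalities rest on this bound.

The inequality `≤` holds at every point. For `x` in the support and `b < p(x)`, take shrinking
intervals `Q_j ∋ x` with quotient above `b`. The rescalings have mean zero and satisfy the same
Poincaré inequality for measures of mass at most one on `Q₀`. Averages over `n + 1` equal pieces
then determine them up to an `L¹` error of order `1/n`, so a subsequence converges
(`exists_subseq_tendsto_unitCube`). Oscillation is continuous in `L¹`, so the limit is a tangent
with oscillation at least `b` on `Q₀`.

The inequality `≥` holds almost everywhere. If a tangent `u` at `x` has `p(x) < q < Osc(u,Q')`,
transporting `Q'` into the approximating `Q_j` gives `R_j ⊆ Q_j` with `q μ(Q_j) < Osc(f,R_j) ≤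
μ(R_j)`. Since `μ(R_j) ≤ μ(Q_j)`, the quotient of `R_j` exceeds `q`, so `R_j` misses the closed set
`F` of points where all quotients at scale at most `η` are `≤ q`. For small `η` the point `x` lies
in `F`, yet a fraction `q` of the mass of arbitrarily short intervals around it lies off `F`. Such
porous points form a null set (`measure_porous_points_eq_zero`), and countably many pairs `(η, q)`
suffice. -/

namespace BVLine

/-! ### Covering by intervals and null sets of porous points -/

/-- A finite family of open intervals has a subfamily with the same union and overlap at most two. -/
theorem exists_subfamily_overlap_le_two (s : Finset (ℝ × ℝ)) :
    ∃ t ⊆ s, (⋃ p ∈ t, Ioo p.1 p.2) = (⋃ p ∈ s, Ioo p.1 p.2) ∧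
      ∀ x : ℝ, (t.filter fun p => x ∈ Ioo p.1 p.2).card ≤ 2 := by
  induction s using Finset.strongInduction with
  | H s ih =>
    by_cases h : ∀ x : ℝ, (s.filter fun p => x ∈ Ioo p.1 p.2).card ≤ 2
    · exact ⟨s, Finset.Subset.refl s, rfl, h⟩
    push Not at h
    obtain ⟨x, hx⟩ := h
    set G := s.filter fun p => x ∈ Ioo p.1 p.2 with hG
    have hne : G.Nonempty := Finset.card_pos.1 (by omega)
    -- Of three intervals through `x`, the one reaching furthest left and the one reaching furthest
    -- right cover the third, which can be discarded.
    obtain ⟨a, ha, ha'⟩ := G.exists_min_image Prod.fst hne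
    obtain ⟨b, hb, hb'⟩ := G.exists_max_image Prod.snd hne
    obtain ⟨q, hq, hqab⟩ : ∃ q ∈ G, q ∉ ({a, b} : Finset (ℝ × ℝ)) := by
      by_contra! hcon
      have := Finset.card_le_card (s := G) (t := {a, b}) hcon
      have := Finset.card_le_two (a := a) (b := b)
      omega
    simp only [Finset.mem_insert, Finset.mem_singleton, not_or] at hqab
    have haG := Finset.mem_filter.1 ha
    have hbG := Finset.mem_filter.1 hb
    have hqG := Finset.mem_filter.1 hq
    obtain ⟨t, hts, htU, hto⟩ := ih (s.erase q) (Finset.erase_ssubset hqG.1)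
    refine ⟨t, hts.trans (Finset.erase_subset _ _), ?_, hto⟩
    rw [htU]
    refine Subset.antisymm (biUnion_mono (fun p hp => Finset.mem_of_mem_erase hp)
      fun _ _ => Subset.rfl) (iUnion₂_subset fun p hp => ?_)
    by_cases hpq : p = q
    · subst hpq
      intro y hy
      rcases le_total y x with hyx | hyx
      · refine mem_biUnion (x := a) (Finset.mem_erase.2 ⟨fun h => hqab.1 h.symm, haG.1⟩) ?_
        exact ⟨(ha' p hq).trans_lt hy.1, hyx.trans_lt haG.2.2⟩
      · refine mem_biUnion (x := b) (Finset.mem_erase.2 ⟨fun h => hqab.2 h.symm, hbG.1⟩) ?_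
        exact ⟨hbG.2.1.trans_le hyx, hy.2.trans_le (hb' p hq)⟩
    · exact subset_biUnion_of_mem (u := fun p : ℝ × ℝ => Ioo p.1 p.2)
        (Finset.mem_erase.2 ⟨hpq, hp⟩)

theorem mul_measure_finset_biUnion_Ioo_le {μ ν : Measure ℝ} {δ : ℝ≥0∞} (s : Finset (ℝ × ℝ))
    (h : ∀ p ∈ s, δ * μ (Ioo p.1 p.2) ≤ ν (Ioo p.1 p.2)) :
    δ * μ (⋃ p ∈ s, Ioo p.1 p.2) ≤ 2 * ν (⋃ p ∈ s, Ioo p.1 p.2) := by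
  obtain ⟨t, hts, htU, hto⟩ := exists_subfamily_overlap_le_two s
  rw [← htU]
  calc δ * μ (⋃ p ∈ t, Ioo p.1 p.2) ≤ δ * ∑ p ∈ t, μ (Ioo p.1 p.2) := by
        gcongr; exact measure_biUnion_finset_le _ _
    _ ≤ ∑ p ∈ t, ν (Ioo p.1 p.2) := by
        rw [Finset.mul_sum]; exact Finset.sum_le_sum fun p hp => h p (hts hp)
    _ = ∫⁻ x, ∑ p ∈ t, (Ioo p.1 p.2).indicator 1 x ∂ν := by
        rw [lintegral_finsetSum _ fun p _ => measurable_one.indicator measurableSet_Ioo]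
        simp [lintegral_indicator_one measurableSet_Ioo]
    _ ≤ ∫⁻ x, (⋃ p ∈ t, Ioo p.1 p.2).indicator (fun _ => 2) x ∂ν := by
        refine lintegral_mono fun x => ?_
        have h1 : ∑ p ∈ t, (Ioo p.1 p.2).indicator (1 : ℝ → ℝ≥0∞) x
            = ((t.filter fun p => x ∈ Ioo p.1 p.2).card : ℝ≥0∞) := by
          simp [indicator_apply]
        by_cases hx : x ∈ ⋃ p ∈ t, Ioo p.1 p.2
        · rw [indicator_of_mem hx, h1]
          exact (Nat.cast_le.2 (hto x)).trans (by simp)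
        · rw [indicator_of_notMem hx]
          refine (Finset.sum_eq_zero fun p hp => indicator_of_notMem (fun hxp => hx ?_) _).le
          exact mem_biUnion (x := p) hp hxp
    _ = 2 * ν (⋃ p ∈ t, Ioo p.1 p.2) :=
        lintegral_indicator_const (Finset.measurableSet_biUnion _ fun _ _ => measurableSet_Ioo) _

/-- Inner regularity of `μ` reduces the union to a compact subset, which finitely many of the
intervals cover. -/
theorem mul_measure_biUnion_Ioo_le {μ ν : Measure ℝ} [IsFiniteMeasure μ] {δ : ℝ≥0∞}
    (S : Set (ℝ × ℝ)) (h : ∀ p ∈ S, δ * μ (Ioo p.1 p.2) ≤ ν (Ioo p.1 p.2)) :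
    δ * μ (⋃ p ∈ S, Ioo p.1 p.2) ≤ 2 * ν (⋃ p ∈ S, Ioo p.1 p.2) := by
  have ho : IsOpen (⋃ p ∈ S, Ioo p.1 p.2) := isOpen_biUnion fun _ _ => isOpen_Ioo
  rw [ho.measure_eq_iSup_isCompact μ]
  simp only [ENNReal.mul_iSup]
  refine iSup_le fun K => iSup_le fun hKU => iSup_le fun hK => ?_
  obtain ⟨b, hbS, hbf, hKb⟩ := hK.elim_finite_subcover_image (fun _ _ => isOpen_Ioo) hKU
  lift b to Finset (ℝ × ℝ) using hbf
  calc δ * μ K ≤ δ * μ (⋃ p ∈ b, Ioo p.1 p.2) := by gcongr; exact hKb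
    _ ≤ 2 * ν (⋃ p ∈ b, Ioo p.1 p.2) :=
        mul_measure_finset_biUnion_Ioo_le b fun p hp => h p (hbS hp)
    _ ≤ _ := mul_le_mul' le_rfl (measure_mono (biUnion_mono hbS fun _ _ => Subset.rfl))

/-- Almost no point of a closed set `F` is contained in arbitrarily short intervals of which a
fixed fraction lies outside `F`. -/
theorem measure_porous_points_eq_zero (μ : Measure ℝ) [IsFiniteMeasure μ] {F : Set ℝ}
    (hF : IsClosed F) {δ : ℝ≥0∞} (hδ : δ ≠ 0) :
    μ {x ∈ F | ∀ ε > 0, ∃ a b : ℝ, b - a < ε ∧ x ∈ Ioo a b ∧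
      δ * μ (Ioo a b) ≤ μ (Ioo a b \ F)} = 0 := by
  set G := {x ∈ F | ∀ ε > 0, ∃ a b : ℝ, b - a < ε ∧ x ∈ Ioo a b ∧
      δ * μ (Ioo a b) ≤ μ (Ioo a b \ F)} with hG
  -- Intervals shorter than `r` that meet `F` stay in the `r`-neighbourhood of `F`. The covering
  -- bound against `μ` restricted to `Fᶜ` therefore sees only the mass of this neighbourhood off
  -- `F`, which vanishes as `r → 0` because `F` is closed.
  have key : ∀ r > 0, δ * μ G ≤ 2 * (μ (Metric.thickening r F) - μ F) := by
    intro r hr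
    set S : Set (ℝ × ℝ) := {p | Ioo p.1 p.2 ⊆ Metric.thickening r F ∧
      δ * μ (Ioo p.1 p.2) ≤ μ (Ioo p.1 p.2 \ F)} with hS
    have hGS : G ⊆ ⋃ p ∈ S, Ioo p.1 p.2 := by
      rintro x ⟨hxF, hx⟩
      obtain ⟨a, b, hab, hxab, h⟩ := hx r hr
      refine mem_biUnion (x := (a, b)) ⟨fun y hy => ?_, h⟩ hxab
      refine Metric.mem_thickening_iff.2 ⟨x, hxF, ?_⟩
      rw [Real.dist_eq, abs_lt]
      constructor <;> linarith [hy.1, hy.2, hxab.1, hxab.2]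
    have h1 := mul_measure_biUnion_Ioo_le (μ := μ) (ν := μ.restrict Fᶜ) (δ := δ) S (by
      intro p hp
      rw [Measure.restrict_apply measurableSet_Ioo]
      exact hp.2)
    rw [Measure.restrict_apply
      (isOpen_biUnion fun _ _ => isOpen_Ioo : IsOpen (⋃ p ∈ S, Ioo p.1 p.2)).measurableSet] at h1
    calc δ * μ G ≤ δ * μ (⋃ p ∈ S, Ioo p.1 p.2) := by gcongr
      _ ≤ 2 * μ ((⋃ p ∈ S, Ioo p.1 p.2) ∩ Fᶜ) := h1
      _ ≤ 2 * μ (Metric.thickening r F \ F) := by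
          gcongr
          exact inter_subset_inter_left _ (iUnion₂_subset fun p hp => hp.1)
      _ = _ := by
          rw [measure_sdiff (Metric.self_subset_thickening hr F) hF.measurableSet.nullMeasurableSet
            (measure_ne_top _ _)]
  have lim : Tendsto (fun r => 2 * (μ (Metric.thickening r F) - μ F)) (𝓝[>] 0) (𝓝 0) := by
    have h1 := tendsto_measure_thickening_of_isClosed (μ := μ) ⟨1, one_pos, measure_ne_top _ _⟩ hF
    have h2 := ENNReal.Tendsto.sub h1 (tendsto_const_nhds (x := μ F))
      (Or.inl (measure_ne_top _ _))
    have h3 := ENNReal.Tendsto.const_mul h2 (a := 2) (Or.inr (by simp))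
    simpa using h3
  have : δ * μ G ≤ 0 := ge_of_tendsto lim (by
    filter_upwards [self_mem_nhdsWithin] with r hr using key r hr)
  simpa [hδ] using this

/-! ### Primitive representation of `f` and the Poincaré inequality -/

theorem exists_Icc_of_isCompact_subset_Ioo {K : Set ℝ} {a b : ℝ} (hK : IsCompact K)
    (hne : K.Nonempty) (hKab : K ⊆ Ioo a b) :
    ∃ a' b', a < a' ∧ b' < b ∧ K ⊆ Icc a' b' :=
  ⟨sInf K, sSup K, (hKab (hK.sInf_mem hne)).1, (hKab (hK.sSup_mem hne)).2, fun _ hx =>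
    ⟨csInf_le hK.bddBelow hx, le_csSup hK.bddAbove hx⟩⟩

/-- A test function with vanishing integral is the derivative of a test function. -/
theorem exists_primitive_of_integral_eq_zero {a b : ℝ} {θ : ℝ → ℝ}
    (hθ : ContDiff ℝ (⊤ : ℕ∞) θ) (hθc : HasCompactSupport θ) (hθab : tsupport θ ⊆ Ioo a b)
    (h0 : ∫ x, θ x = 0) :
    ∃ ψ : ℝ → ℝ, ContDiff ℝ (⊤ : ℕ∞) ψ ∧ HasCompactSupport ψ ∧ tsupport ψ ⊆ Ioo a b ∧
      deriv ψ = θ := by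
  rcases (tsupport θ).eq_empty_or_nonempty with hemp | hne
  · have : θ = 0 := by rwa [tsupport_eq_empty_iff] at hemp
    subst this
    exact ⟨0, contDiff_const, HasCompactSupport.zero, by simp, by simp⟩
  obtain ⟨a', b', ha', hb', hK⟩ := exists_Icc_of_isCompact_subset_Ioo hθc hne hθab
  have hout : ∀ x, x ∉ Icc a' b' → θ x = 0 := fun x hx =>
    image_eq_zero_of_notMem_tsupport fun h => hx (hK h)
  set ψ : ℝ → ℝ := fun t => ∫ x in a'..t, θ x with hψ
  have hder : ∀ t, HasDerivAt ψ (θ t) t := fun t =>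
    intervalIntegral.integral_hasDerivAt_right (hθ.continuous.intervalIntegrable _ _)
      (hθ.continuous.stronglyMeasurableAtFilter _ _) hθ.continuous.continuousAt
  have hderiv : deriv ψ = θ := funext fun t => (hder t).deriv
  have hsupp : tsupport ψ ⊆ Icc a' b' := by
    refine closure_minimal (fun t ht => ?_) isClosed_Icc
    by_contra hcon
    refine ht ?_
    rw [mem_Icc, not_and_or, not_le, not_le] at hcon
    rcases hcon with h | h
    · change ∫ x in a'..t, θ x = 0
      rw [intervalIntegral.integral_symm, intervalIntegral.integral_of_le h.le,
        integral_Ioc_eq_integral_Ioo, setIntegral_eq_zero_of_forall_eq_zero, neg_zero]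
      exact fun x hx => hout x fun hx' => hx'.1.not_gt hx.2
    -- To the right of `b'` the primitive equals the full integral of `θ`; this is where `h0`
    -- enters.
    · change ∫ x in a'..t, θ x = 0
      have hat : a' ≤ t := (hne.elim fun y hy => (hK hy).1.trans (hK hy).2).trans h.le
      rw [intervalIntegral.integral_of_le hat, ← integral_Icc_eq_integral_Ioc, ← h0]
      exact setIntegral_eq_integral_of_forall_compl_eq_zero fun x hx =>
        hout x fun hx' => hx ⟨hx'.1, hx'.2.trans h.le⟩
  refine ⟨ψ, ?_, isCompact_Icc.of_isClosed_subset (isClosed_tsupport _) hsupp,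
    hsupp.trans fun x hx => ⟨ha'.trans_le hx.1, hx.2.trans_lt hb'⟩, hderiv⟩
  rw [contDiff_infty_iff_deriv, hderiv]
  exact ⟨fun t => (hder t).differentiableAt, hθ⟩

/-- The du Bois-Reymond lemma: a function with vanishing distributional derivative on an interval
is constant. -/
theorem ae_eq_const_of_integral_mul_deriv_eq_zero {a b : ℝ} (hab : a < b) {g : ℝ → ℝ}
    (hg : IntegrableOn g (Ioo a b))
    (h : ∀ ψ : ℝ → ℝ, ContDiff ℝ (⊤ : ℕ∞) ψ → HasCompactSupport ψ → tsupport ψ ⊆ Ioo a b →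
      ∫ x in Ioo a b, g x * deriv ψ x = 0) :
    ∃ C : ℝ, ∀ᵐ x, x ∈ Ioo a b → g x = C := by
  let B : ContDiffBump ((a + b) / 2) :=
    { rIn := (b - a) / 8, rOut := (b - a) / 4, rIn_pos := by linarith, rIn_lt_rOut := by linarith }
  set η : ℝ → ℝ := B.normed volume with hη
  have hηs : ContDiff ℝ (⊤ : ℕ∞) η := B.contDiff_normed
  have hηc : HasCompactSupport η := B.hasCompactSupport_normed
  have hηab : tsupport η ⊆ Ioo a b := by
    rw [hη, B.tsupport_normed_eq, Real.closedBall_eq_Icc]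
    change Icc ((a + b) / 2 - (b - a) / 4) ((a + b) / 2 + (b - a) / 4) ⊆ _
    intro x hx
    constructor <;> linarith [hx.1, hx.2]
  have hη1 : ∫ x, η x = 1 := B.integral_normed
  have hint : ∀ φ : ℝ → ℝ, Continuous φ → HasCompactSupport φ →
      IntegrableOn (fun x => g x * φ x) (Ioo a b) := by
    intro φ hφ hφc
    obtain ⟨M, hM⟩ := hφc.exists_bound_of_continuous hφ
    exact Integrable.mul_bdd (c := M) hg hφ.aestronglyMeasurable (Eventually.of_forall hM)
  set C := ∫ x in Ioo a b, g x * η x with hC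
  refine ⟨C, ?_⟩
  have key := isOpen_Ioo.ae_eq_zero_of_integral_contDiff_smul_eq_zero (U := Ioo a b) (μ := volume)
    (f := fun x => g x - C)
    (hg.sub (integrableOn_const (by simp))).locallyIntegrableOn (by
      intro φ hφ hφc hφab
      -- Since `η` has integral one, `φ - cη` has integral zero and is the derivative of a test
      -- function; testing `g` with it gives `∫ gφ = C ∫ φ`.
      set c := ∫ x, φ x with hc
      have hcη : HasCompactSupport fun x => c * η x := hηc.mul_left
      obtain ⟨ψ, hψ, hψc, hψab, hψd⟩ := exists_primitive_of_integral_eq_zero (a := a) (b := b)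
        (θ := φ - fun x => c * η x) (hφ.sub (contDiff_const.mul hηs))
        (hφc.sub hcη)
        ((tsupport_sub _ _).trans (union_subset hφab
          ((tsupport_mul_subset_right (f := fun _ => c) (g := η)).trans hηab)))
        (by
          simp only [Pi.sub_apply]
          rw [integral_sub (hφ.continuous.integrable_of_hasCompactSupport hφc)
            ((hηs.continuous.integrable_of_hasCompactSupport hηc).const_mul c),
            integral_const_mul, hη1]
          simp [hc])
      have h1 := h ψ hψ hψc hψab
      rw [hψd] at h1
      have hφ0 : ∀ x, x ∉ Ioo a b → φ x = 0 := fun x hx =>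
        image_eq_zero_of_notMem_tsupport fun h => hx (hφab h)
      have h2 : ∫ x in Ioo a b, φ x = c :=
        setIntegral_eq_integral_of_forall_compl_eq_zero hφ0
      rw [← setIntegral_eq_integral_of_forall_compl_eq_zero (s := Ioo a b)
        (fun x hx => by simp [hφ0 x hx])]
      have e1 : ∀ x, g x * (φ - fun x => c * η x) x = g x * φ x - c * (g x * η x) := by
        intro x; simp only [Pi.sub_apply]; ring
      have e2 : ∀ x, φ x • (g x - C) = g x * φ x - C * φ x := by
        intro x; simp only [smul_eq_mul]; ring
      simp only [e1] at h1
      simp only [e2]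
      rw [integral_sub (hint φ hφ.continuous hφc) ((hint η hηs.continuous hηc).const_mul c),
        integral_const_mul, ← hC] at h1
      rw [integral_sub (hint φ hφ.continuous hφc)
        ((hφ.continuous.integrable_of_hasCompactSupport hφc).integrableOn.const_mul C),
        integral_const_mul, h2]
      linarith)
  filter_upwards [key] with x hx hxab
  linarith [hx hxab]

/-- By Fubini the function `F(t) = Df((a,t])` has the same distributional derivative as `f` on
`(a,b)`, so du Bois-Reymond applies to `f - F`. -/
theorem IsPolarDeriv.exists_ae_eq_primitive {I : Set ℝ} {f σ : ℝ → ℝ} {μ : Measure ℝ}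
    (h : IsPolarDeriv I f μ σ) (hf : LocallyIntegrableOn f I) {a b : ℝ} (hab : a < b)
    (hI : Icc a b ⊆ I) :
    ∃ C : ℝ, ∀ᵐ t, t ∈ Ioo a b → f t = C + ∫ s in Ioo a b, (Iic t).indicator σ s ∂μ := by
  have hfin : IsFiniteMeasure (μ.restrict (Ioo a b)) := ⟨by
    rw [Measure.restrict_apply_univ]
    exact (measure_mono Ioo_subset_Icc_self).trans_lt (h.compact_lt_top _ isCompact_Icc hI)⟩
  have hfi : IntegrableOn f (Ioo a b) :=
    (hf.integrableOn_compact_subset hI isCompact_Icc).mono_set Ioo_subset_Icc_self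
  set ν := μ.restrict (Ioo a b) with hν
  have hσ : ∀ᵐ s ∂ν, |σ s| = 1 := ae_restrict_of_ae h.abs_density
  have hmeas2 : Measurable fun p : ℝ × ℝ => (Iic p.1).indicator σ p.2 := by
    have : (fun p : ℝ × ℝ => (Iic p.1).indicator σ p.2)
        = {p : ℝ × ℝ | p.2 ≤ p.1}.indicator fun p => σ p.2 := by
      ext p; simp [indicator_apply]
    rw [this]
    exact (h.measurable_density.comp measurable_snd).indicator
      (measurableSet_le measurable_snd measurable_fst)
  set F : ℝ → ℝ := fun t => ∫ s, (Iic t).indicator σ s ∂ν with hF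
  have hFm : StronglyMeasurable F := hmeas2.stronglyMeasurable.integral_prod_right
  have hFb : ∀ t, ‖F t‖ ≤ ν.real univ := by
    intro t
    have := norm_integral_le_of_norm_le_const (μ := ν) (f := fun s => (Iic t).indicator σ s)
      (C := 1) (by
        filter_upwards [hσ] with s hs
        refine (norm_indicator_le_norm_self _ _).trans ?_
        rw [Real.norm_eq_abs, hs])
    simpa using this
  have hFi : IntegrableOn F (Ioo a b) :=
    Measure.integrableOn_of_bounded (by simp) hFm.aestronglyMeasurable (Eventually.of_forall hFb)
  obtain ⟨C, hC⟩ := ae_eq_const_of_integral_mul_deriv_eq_zero hab (g := fun t => f t - F t)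
    (hfi.sub hFi) (by
      intro ψ hψ hψc hψab
      have hψ0 : ∀ x, x ∉ Ioo a b → ψ x = 0 := fun x hx =>
        image_eq_zero_of_notMem_tsupport fun h => hx (hψab h)
      have hdψ0 : ∀ x, x ∉ Ioo a b → deriv ψ x = 0 := fun x hx =>
        image_eq_zero_of_notMem_tsupport fun h => hx (hψab (tsupport_deriv_subset h))
      have hdc : Continuous (deriv ψ) := hψ.continuous_deriv (by simp)
      obtain ⟨M, hM⟩ := hψc.deriv.exists_bound_of_continuous hdc
      have hbd := fun (u : ℝ → ℝ) (hu : IntegrableOn u (Ioo a b)) =>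
        Integrable.mul_bdd (c := M) hu hdc.aestronglyMeasurable (Eventually.of_forall hM)
      have h1 : ∫ x in Ioo a b, f x * deriv ψ x = - ∫ x, ψ x * σ x ∂μ := by
        rw [← h.integral_eq ψ hψ hψc (hψab.trans (Ioo_subset_Icc_self.trans hI)),
          setIntegral_eq_integral_of_forall_compl_eq_zero fun x hx => by simp [hdψ0 x hx],
          setIntegral_eq_integral_of_forall_compl_eq_zero fun x hx => by
            simp [hdψ0 x fun hx' => hx (hI (Ioo_subset_Icc_self hx'))]]
      have h2 : ∫ x in Ioo a b, F x * deriv ψ x = - ∫ x, ψ x * σ x ∂μ := by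
        have e1 : ∀ x, F x * deriv ψ x = ∫ s, (Iic x).indicator σ s * deriv ψ x ∂ν := fun x =>
          (integral_mul_const _ _).symm
        simp only [e1]
        rw [integral_integral_swap]
        · have e2 : ∀ s ∈ Ioo a b,
              ∫ x in Ioo a b, (Iic x).indicator σ s * deriv ψ x = -(ψ s * σ s) := by
            intro s hs
            have e3 : ∀ x, (Iic x).indicator σ s * deriv ψ x
                = (Ici s).indicator (fun x => σ s * deriv ψ x) x := fun x => by
              simp [indicator_apply]
            have e4 : Ioo a b ∩ Ici s = Ico s b := by
              ext x
              simp only [mem_inter_iff, mem_Ioo, mem_Ici, mem_Ico]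
              exact ⟨fun hx => ⟨hx.2, hx.1.2⟩, fun hx => ⟨⟨hs.1.trans_le hx.1, hx.2⟩, hx.1⟩⟩
            simp only [e3]
            rw [setIntegral_indicator measurableSet_Ici, e4, integral_const_mul,
              integral_Ico_eq_integral_Ioc, ← intervalIntegral.integral_of_le hs.2.le,
              intervalIntegral.integral_deriv_eq_sub
                (fun x _ => (hψ.differentiable (by simp)).differentiableAt)
                (hdc.intervalIntegrable _ _), hψ0 b (by simp)]
            ring
          rw [hν, setIntegral_congr_fun measurableSet_Ioo e2, integral_neg,
            setIntegral_eq_integral_of_forall_compl_eq_zero fun x hx => by simp [hψ0 x hx]]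
        · refine Integrable.of_bound (C := M) (hmeas2.mul
            (hdc.measurable.comp measurable_fst)).aestronglyMeasurable ?_
          filter_upwards [Measure.quasiMeasurePreserving_snd.ae hσ] with p hp
          have hM0 : ‖deriv ψ p.1‖ ≤ M := hM p.1
          have h1 : ‖(Iic p.1).indicator σ p.2‖ ≤ 1 :=
            (norm_indicator_le_norm_self _ _).trans (by rw [Real.norm_eq_abs, hp])
          change ‖(Iic p.1).indicator σ p.2 * deriv ψ p.1‖ ≤ M
          rw [norm_mul]
          nlinarith [norm_nonneg (deriv ψ p.1)]
      simp only [sub_mul]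
      rw [integral_sub (hbd f hfi) (hbd F hFi), h1, h2, sub_self])
  refine ⟨C, ?_⟩
  filter_upwards [hC] with t ht htab
  linarith [ht htab]

/-- Two values of the primitive differ by the `Df`-mass of an interval between them. Almost all
values of `f` thus lie in a closed ball of radius `μ(a,b)` about any typical one, and by convexity
so does the average. -/
theorem IsPolarDeriv.osc_le {I : Set ℝ} {f σ : ℝ → ℝ} {μ : Measure ℝ}
    (h : IsPolarDeriv I f μ σ) (hf : LocallyIntegrableOn f I) {a b : ℝ} (hab : a < b)
    (hI : Icc a b ⊆ I) : osc f (Ioo a b) ≤ μ (Ioo a b) := by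
  have hlt : μ (Ioo a b) < ∞ :=
    (measure_mono Ioo_subset_Icc_self).trans_lt (h.compact_lt_top _ isCompact_Icc hI)
  have hfin : IsFiniteMeasure (μ.restrict (Ioo a b)) := ⟨by rwa [Measure.restrict_apply_univ]⟩
  have hfi : IntegrableOn f (Ioo a b) :=
    (hf.integrableOn_compact_subset hI isCompact_Icc).mono_set Ioo_subset_Icc_self
  obtain ⟨C, hC⟩ := h.exists_ae_eq_primitive hf hab hI
  set ν := μ.restrict (Ioo a b) with hν
  have hσ : ∀ᵐ s ∂ν, |σ s| = 1 := ae_restrict_of_ae h.abs_density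
  have hind : ∀ t, Integrable (fun s => (Iic t).indicator σ s) ν := by
    intro t
    refine Integrable.indicator (Integrable.of_bound h.measurable_density.aestronglyMeasurable 1 ?_)
      measurableSet_Iic
    filter_upwards [hσ] with s hs
    rw [Real.norm_eq_abs, hs]
  have hF : ∀ t t', ‖(∫ s, (Iic t).indicator σ s ∂ν) - ∫ s, (Iic t').indicator σ s ∂ν‖
      ≤ μ.real (Ioo a b) := by
    intro t t'
    rw [← integral_sub (hind t) (hind t')]
    refine (norm_integral_le_of_norm_le_const (C := 1) ?_).trans (by simp [hν])
    filter_upwards [hσ] with s hs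
    simp only [indicator_apply]
    split_ifs <;> simp [hs]
  have hC' : ∀ᵐ t ∂(volume.restrict (Ioo a b)),
      f t = C + ∫ s in Ioo a b, (Iic t).indicator σ s ∂μ :=
    (ae_restrict_iff' measurableSet_Ioo).2 hC
  have hvol : volume (Ioo a b) ≠ 0 := by simp [hab]
  have hbd : ∀ᵐ y ∂(volume.restrict (Ioo a b)), ‖f y - ⨍ z in Ioo a b, f z‖ₑ ≤ μ (Ioo a b) := by
    filter_upwards [hC'] with y hy
    have hmem : (⨍ z in Ioo a b, f z) ∈ Metric.closedBall (f y) (μ.real (Ioo a b)) := by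
      refine (convex_closedBall _ _).set_average_mem Metric.isClosed_closedBall hvol (by simp) ?_ hfi
      filter_upwards [hC'] with z hz
      rw [mem_closedBall_iff_norm, hz, hy, add_sub_add_left_eq_sub]
      exact hF z y
    rw [mem_closedBall_iff_norm'] at hmem
    rw [← ofReal_norm]
    exact ENNReal.ofReal_le_of_le_toReal hmem
  calc osc f (Ioo a b) ≤ ⨍⁻ _ in Ioo a b, μ (Ioo a b) ∂volume := laverage_mono_ae hbd
    _ = μ (Ioo a b) := setLAverage_const hvol (by simp) _

/-! ### Compactness in `L¹(Q₀)` -/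

/-- The `k`-th open interval of the partition of the unit cube into `n + 1` equal parts. -/
def part (n k : ℕ) : Set ℝ :=
  Ioo (-1 / 2 + (k : ℝ) / (n + 1)) (-1 / 2 + ((k + 1 : ℕ) : ℝ) / (n + 1))

theorem part_lt (n k : ℕ) :
    -1 / 2 + (k : ℝ) / (n + 1) < -1 / 2 + ((k + 1 : ℕ) : ℝ) / (n + 1) := by
  gcongr; omega

theorem volume_part (n k : ℕ) : volume (part n k) = (n + 1 : ℝ≥0∞)⁻¹ := by
  rw [part, Real.volume_Ioo, show (-1 / 2 + ((k + 1 : ℕ) : ℝ) / (n + 1))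
    - (-1 / 2 + (k : ℝ) / (n + 1)) = ((n + 1 : ℕ) : ℝ)⁻¹ by push_cast; ring,
    ENNReal.ofReal_inv_of_pos (by positivity), ENNReal.ofReal_natCast]
  push_cast; rfl

theorem part_subset_unitCube {n k : ℕ} (hk : k ∈ Finset.range (n + 1)) :
    part n k ⊆ unitCube := by
  refine Ioo_subset_Ioo (by linarith [show 0 ≤ (k : ℝ) / (n + 1) by positivity]) ?_
  have : ((k + 1 : ℕ) : ℝ) / (n + 1) ≤ 1 := by
    rw [div_le_one (by positivity)]
    exact_mod_cast Finset.mem_range.1 hk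
  linarith

theorem sum_measure_part_le (m : Measure ℝ) (n : ℕ) :
    ∑ k ∈ Finset.range (n + 1), m (part n k) ≤ m unitCube := by
  rw [← measure_biUnion_finset (f := part n) _ fun _ _ => measurableSet_Ioo]
  · exact measure_mono (iUnion₂_subset fun k hk => part_subset_unitCube hk)
  · intro i _ j _ hij
    have key : ∀ i j : ℕ, i < j → Disjoint (part n i) (part n j) := by
      intro i j hij
      refine Set.disjoint_left.2 fun x hx hx' => (hx.2.trans_le ?_).not_gt hx'.1
      gcongr; omega
    rcases lt_or_gt_of_ne hij with h | h
    · exact key i j h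
    · exact (key j i h).symm

theorem setLIntegral_unitCube_le (g : ℝ → ℝ≥0∞) (n : ℕ) :
    ∫⁻ x in unitCube, g x ≤ ∑ k ∈ Finset.range (n + 1), ∫⁻ x in part n k, g x := by
  set t : ℕ → ℝ := fun k => -1 / 2 + (k : ℝ) / (n + 1) with ht
  -- Half-open pieces cover every point, with index `⌊(x + 1/2)(n + 1)⌋`; they differ from the open
  -- pieces by null sets.
  have hcov : unitCube ⊆ ⋃ k ∈ Finset.range (n + 1), Ico (t k) (t (k + 1)) := by
    intro x hx
    have hx1 : 0 < x + 1 / 2 := by linarith [hx.1]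
    have hx2 : x + 1 / 2 < 1 := by linarith [hx.2]
    have hn : (0 : ℝ) < n + 1 := by positivity
    have h1 := Nat.floor_le (a := (x + 1 / 2) * (n + 1)) (by positivity)
    have h2 := Nat.lt_floor_add_one ((x + 1 / 2) * (n + 1))
    refine mem_biUnion (x := ⌊(x + 1 / 2) * (n + 1)⌋₊) ?_ ⟨?_, ?_⟩
    · simp only [Finset.coe_range, mem_Iio]
      rw [Nat.floor_lt (by positivity)]
      push_cast
      nlinarith
    · have := (div_le_iff₀ hn).2 h1
      simp only [ht]
      linarith
    · have := (lt_div_iff₀ hn).2 h2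
      simp only [ht]
      push_cast
      linarith
  calc ∫⁻ x in unitCube, g x
      ≤ ∫⁻ x in ⋃ k ∈ Finset.range (n + 1), Ico (t k) (t (k + 1)), g x := lintegral_mono_set hcov
    _ ≤ ∑ k ∈ Finset.range (n + 1), ∫⁻ x in Ico (t k) (t (k + 1)), g x := by
        rw [← Finset.set_biUnion_coe, biUnion_eq_iUnion]
        refine (lintegral_iUnion_le _ _).trans_eq ?_
        rw [tsum_fintype]
        exact Finset.sum_coe_sort (Finset.range (n + 1))
          fun k => ∫⁻ x in Ico (t k) (t (k + 1)), g x
    _ = _ := Finset.sum_congr rfl fun k _ => by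
        rw [Measure.restrict_congr_set Ioo_ae_eq_Ico.symm]; rfl

theorem setLIntegral_enorm_sub_average_eq (v : ℝ → ℝ) (a b : ℝ) :
    ∫⁻ x in Ioo a b, ‖v x - ⨍ z in Ioo a b, v z‖ₑ = volume (Ioo a b) * osc v (Ioo a b) := by
  rw [osc, measure_mul_setLAverage _ (by simp)]

theorem setLIntegral_enorm_sub_le {v w : ℝ → ℝ} {a b : ℝ}
    (hv : IntegrableOn v (Ioo a b)) (hw : IntegrableOn w (Ioo a b)) :
    ∫⁻ x in Ioo a b, ‖v x - w x‖ₑ ≤ volume (Ioo a b) * (osc v (Ioo a b) + osc w (Ioo a b) +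
      edist (⨍ z in Ioo a b, v z) (⨍ z in Ioo a b, w z)) := by
  set A := ⨍ z in Ioo a b, v z with hA
  set B := ⨍ z in Ioo a b, w z with hB
  calc ∫⁻ x in Ioo a b, ‖v x - w x‖ₑ
      ≤ ∫⁻ x in Ioo a b, (‖v x - A‖ₑ + ‖w x - B‖ₑ + edist A B) := by
        refine lintegral_mono fun x => ?_
        rw [edist_eq_enorm_sub]
        calc ‖v x - w x‖ₑ = ‖(v x - A) - (w x - B) + (A - B)‖ₑ := by congr 1; ring
          _ ≤ ‖(v x - A) - (w x - B)‖ₑ + ‖A - B‖ₑ := enorm_add_le _ _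
          _ ≤ _ := by gcongr; exact enorm_sub_le
    _ = _ := by
        have h1 : AEMeasurable (fun x => ‖v x - A‖ₑ) (volume.restrict (Ioo a b)) :=
          (hv.aestronglyMeasurable.sub aestronglyMeasurable_const).enorm
        have h2 : AEMeasurable (fun x => ‖w x - B‖ₑ) (volume.restrict (Ioo a b)) :=
          (hw.aestronglyMeasurable.sub aestronglyMeasurable_const).enorm
        have h3 := lintegral_add_left' (h1.add h2) fun _ => edist A B
        simp only [Pi.add_apply] at h3
        rw [h3, lintegral_add_left' h1,
          setLIntegral_enorm_sub_average_eq v, setLIntegral_enorm_sub_average_eq w,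
          setLIntegral_const]
        ring

/-- Compactness in `L¹(Q₀)` of sequences that satisfy a uniform Poincaré inequality. -/
theorem exists_subseq_tendsto_unitCube {v : ℕ → ℝ → ℝ} (hv : ∀ j, IntegrableOn (v j) unitCube)
    {m : ℕ → Measure ℝ} (hm : ∀ j, m j unitCube ≤ 1)
    (hosc : ∀ j a b, a < b → Ioo a b ⊆ unitCube → osc (v j) (Ioo a b) ≤ m j (Ioo a b))
    (h0 : ∀ j, ⨍ x in unitCube, v j x = 0) :
    ∃ u : ℝ → ℝ, IntegrableOn u unitCube ∧ ∃ φ : ℕ → ℕ, StrictMono φ ∧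
      Tendsto (fun j => ∫⁻ y in unitCube, ‖v (φ j) y - u y‖ₑ) atTop (𝓝 0) := by
  have hvol : volume unitCube = 1 := by
    rw [unitCube, Real.volume_Ioo]; norm_num
  -- With mean zero, the oscillation on the whole cube is the `L¹` norm.
  have hL1 : ∀ j, ∫ x in unitCube, ‖v j x‖ ≤ 1 := by
    intro j
    have h1 := hosc j (-1 / 2) (1 / 2) (by norm_num) Subset.rfl
    have h2 := setLIntegral_enorm_sub_average_eq (v j) (-1 / 2) (1 / 2)
    change osc (v j) unitCube ≤ m j unitCube at h1
    change ∫⁻ x in unitCube, ‖v j x - ⨍ z in unitCube, v j z‖ₑ =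
      volume unitCube * osc (v j) unitCube at h2
    rw [h0, hvol, one_mul] at h2
    simp only [sub_zero] at h2
    rw [integral_norm_eq_lintegral_enorm (hv j).aestronglyMeasurable, h2]
    exact ENNReal.toReal_le_of_le_ofReal zero_le_one (by simpa using h1.trans (hm j))
  set M : ℕ × ℕ → ℝ := fun p => (volume.real (part p.1 p.2))⁻¹ with hM
  -- All averages, over all partitions at once, form a point of a product of compact balls;
  -- Tychonoff replaces a diagonal argument. Indices that name no piece carry the dummy value `0`.
  set A : ℕ → ℕ × ℕ → ℝ := fun j p =>
    if p.2 ∈ Finset.range (p.1 + 1) then ⨍ x in part p.1 p.2, v j x else 0 with hA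
  have hAM : ∀ j, A j ∈ univ.pi fun p => Metric.closedBall (0 : ℝ) (M p) := by
    intro j p _
    rw [mem_closedBall_zero_iff]
    have hM0 : 0 ≤ M p := inv_nonneg.2 measureReal_nonneg
    simp only [hA]
    split_ifs with hp
    · rw [setAverage_eq, norm_smul, Real.norm_of_nonneg hM0]
      refine mul_le_of_le_one_right hM0 ((norm_integral_le_integral_norm _).trans
        (le_trans ?_ (hL1 j)))
      exact setIntegral_mono_set (hv j).norm (Eventually.of_forall fun _ => norm_nonneg _)
        (part_subset_unitCube hp).eventuallyLE
    · simpa using hM0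
  obtain ⟨Λ, -, φ, hφ, hlim⟩ :=
    (isCompact_univ_pi fun p => isCompact_closedBall (0 : ℝ) (M p)).tendsto_subseq hAM
  have hlimp : ∀ p, Tendsto (fun j => edist (A (φ j) p) (Λ p)) atTop (𝓝 0) := fun p =>
    tendsto_iff_edist_tendsto_0.1 (tendsto_pi_nhds.1 hlim p)
  set w : ℕ → (ℝ →₁[volume.restrict unitCube] ℝ) := fun j => (hv (φ j)).toL1 (v (φ j)) with hw
  have hedist : ∀ i (g : ℝ → ℝ) (hg : Integrable g (volume.restrict unitCube)),
      edist (w i) (hg.toL1 g) = ∫⁻ x in unitCube, ‖v (φ i) x - g x‖ₑ := by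
    intro i g hg
    simp only [← edist_eq_enorm_sub (E := ℝ)]
    exact Integrable.edist_toL1_toL1 _ _ (hv (φ i)) hg
  -- The factor is the length of one piece, and the `2` is the total mass of the two measures:
  -- summing the Poincaré bounds over the pieces costs no more than that.
  have hest : ∀ (n : ℕ) i j, edist (w i) (w j) ≤ (n + 1 : ℝ≥0∞)⁻¹ *
      (2 + (∑ k ∈ Finset.range (n + 1), edist (A (φ i) (n, k)) (Λ (n, k))
        + ∑ k ∈ Finset.range (n + 1), edist (A (φ j) (n, k)) (Λ (n, k)))) := by
    intro n i j
    refine (hedist i _ (hv (φ j))).trans_le ?_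
    refine (setLIntegral_unitCube_le _ n).trans ?_
    calc ∑ k ∈ Finset.range (n + 1), ∫⁻ x in part n k, ‖v (φ i) x - v (φ j) x‖ₑ
        ≤ ∑ k ∈ Finset.range (n + 1), (n + 1 : ℝ≥0∞)⁻¹ *
          (m (φ i) (part n k) + m (φ j) (part n k) +
            (edist (A (φ i) (n, k)) (Λ (n, k)) + edist (A (φ j) (n, k)) (Λ (n, k)))) := by
          refine Finset.sum_le_sum fun k hk => ?_
          have hs := part_subset_unitCube hk
          have h1 := setLIntegral_enorm_sub_le ((hv (φ i)).mono_set hs)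
            ((hv (φ j)).mono_set hs)
          change ∫⁻ x in part n k, ‖v (φ i) x - v (φ j) x‖ₑ ≤ volume (part n k) * _ at h1
          rw [volume_part] at h1
          refine h1.trans ?_
          gcongr
          · exact hosc _ _ _ (part_lt n k) hs
          · exact hosc _ _ _ (part_lt n k) hs
          · have e : ∀ j, A j (n, k) = ⨍ x in part n k, v j x := fun j => if_pos hk
            rw [e, e]
            exact edist_triangle_right _ _ _
      _ ≤ _ := by
          rw [← Finset.mul_sum, Finset.sum_add_distrib, Finset.sum_add_distrib,
            Finset.sum_add_distrib]
          gcongr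
          rw [← one_add_one_eq_two]
          exact add_le_add ((sum_measure_part_le _ n).trans (hm _))
            ((sum_measure_part_le _ n).trans (hm _))
  have hcau : CauchySeq w := by
    refine EMetric.cauchySeq_iff.2 fun ε hε => ?_
    obtain ⟨n, hn⟩ : ∃ n : ℕ, (n + 1 : ℝ≥0∞)⁻¹ * 4 < ε := by
      obtain ⟨n, hn⟩ := ENNReal.exists_inv_nat_lt (ENNReal.div_pos hε.ne' (by simp : (4 : ℝ≥0∞) ≠ ∞)).ne'
      refine ⟨n, ?_⟩
      have : (n + 1 : ℝ≥0∞)⁻¹ < ε / 4 := lt_of_le_of_lt (by gcongr; exact le_self_add) hn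
      exact (ENNReal.lt_div_iff_mul_lt (by simp) (by simp)).1 this
    have hs : Tendsto (fun j => ∑ k ∈ Finset.range (n + 1), edist (A (φ j) (n, k)) (Λ (n, k)))
        atTop (𝓝 0) := by
      simpa using tendsto_finsetSum (Finset.range (n + 1)) fun k _ => hlimp (n, k)
    obtain ⟨N, hN⟩ := eventually_atTop.1 (hs.eventually (gt_mem_nhds one_pos))
    refine ⟨N, fun i hi j hj => (hest n i j).trans_lt (lt_of_le_of_lt ?_ hn)⟩
    gcongr
    calc _ ≤ (2 : ℝ≥0∞) + (1 + 1) := by gcongr; exacts [(hN i hi).le, (hN j hj).le]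
      _ = 4 := by norm_num
  obtain ⟨u, hu⟩ := cauchySeq_tendsto_of_complete hcau
  refine ⟨u, L1.integrable_coeFn u, φ, hφ, ?_⟩
  have h1 := tendsto_iff_edist_tendsto_0.1 hu
  refine h1.congr fun j => ?_
  conv_lhs => rw [← Integrable.toL1_coeFn u (L1.integrable_coeFn u)]
  exact hedist j _ _

/-! ### Affine changes of variable and `L¹`-continuity of the oscillation -/

theorem cube_eq_ball (c l : ℝ) : cube c l = Metric.ball c (l / 2) := (Real.ball_eq_Ioo _ _).symm

theorem isOpen_cube (c l : ℝ) : IsOpen (cube c l) := isOpen_Ioo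

theorem unitCube_eq_cube : unitCube = cube 0 1 := by
  simp only [unitCube, cube]; congr 1 <;> norm_num

theorem volume_cube (c l : ℝ) : volume (cube c l) = ENNReal.ofReal l := by
  rw [cube, Real.volume_Ioo]; congr 1; ring

theorem volume_cube_ne_zero {c l : ℝ} (hl : 0 < l) : volume (cube c l) ≠ 0 := by
  simp [volume_cube, hl]

theorem volume_cube_ne_top (c l : ℝ) : volume (cube c l) ≠ ∞ := by simp [volume_cube]

theorem le_of_cube_subset_cube {c l c' l' : ℝ} (hl : 0 ≤ l) (h : cube c' l' ⊆ cube c l) :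
    l' ≤ l := by
  have := measure_mono (μ := volume) h
  rwa [volume_cube, volume_cube, ENNReal.ofReal_le_ofReal_iff hl] at this

theorem preimage_affine_cube (c c' l' : ℝ) {k : ℝ} (hk : k ≠ 0) :
    (fun y => c + k * y) ⁻¹' cube (c + k * c') (|k| * l') = cube c' l' := by
  ext y
  have h1 : c + k * y - (c + k * c') = k * (y - c') := by ring
  rw [mem_preimage, cube_eq_ball, cube_eq_ball, Metric.mem_ball, Metric.mem_ball, Real.dist_eq,
    Real.dist_eq, h1, abs_mul, mul_div_assoc, mul_lt_mul_iff_right₀ (abs_pos.2 hk)]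

theorem preimage_affine_symm_cube (c c' l' : ℝ) {k : ℝ} (hk : k ≠ 0) :
    (fun z => k⁻¹ * (z - c)) ⁻¹' cube c' l' = cube (c + k * c') (|k| * l') := by
  rw [← preimage_affine_cube c c' l' hk, ← preimage_comp]
  have : ((fun y => c + k * y) ∘ fun z => k⁻¹ * (z - c)) = id := by
    ext z; simp [hk]
  rw [this, preimage_id]

theorem affine_cube_subset {c c' l' : ℝ} {k : ℝ} (hk : k ≠ 0) (h : cube c' l' ⊆ unitCube) :
    cube (c + k * c') (|k| * l') ⊆ cube c |k| := by
  have := preimage_mono (f := fun z => k⁻¹ * (z - c)) h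
  rw [unitCube_eq_cube, preimage_affine_symm_cube c c' l' hk,
    preimage_affine_symm_cube c 0 1 hk] at this
  simpa using this

theorem measurableEmbedding_affine (c : ℝ) {k : ℝ} (hk : k ≠ 0) :
    MeasurableEmbedding fun y : ℝ => c + k * y :=
  ((Homeomorph.mulLeft₀ k hk).trans (Homeomorph.addLeft c)).measurableEmbedding

theorem map_affine_volume (c : ℝ) {k : ℝ} (hk : k ≠ 0) :
    (volume : Measure ℝ).map (fun y => c + k * y) = ENNReal.ofReal |k⁻¹| • volume := by
  have : (fun y => c + k * y) = (fun y => c + y) ∘ (fun y => k * y) := rfl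
  rw [this, ← Measure.map_map (measurable_const_add c) (measurable_const_mul k),
    Real.map_volume_mul_left hk, Measure.map_smul, map_add_left_eq_self]

/-- The Jacobian cancels in the normalized measure, so averages and oscillations are affine
invariant. Using `|k|` covers orientation-reversing maps too. -/
theorem map_affine_cond_cube (c c' l' : ℝ) {k : ℝ} (hk : k ≠ 0) :
    ((volume (cube c' l'))⁻¹ • volume.restrict (cube c' l')).map (fun y => c + k * y) =
      (volume (cube (c + k * c') (|k| * l')))⁻¹ •
        volume.restrict (cube (c + k * c') (|k| * l')) := by
  have hT := measurableEmbedding_affine c hk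
  set S := cube (c + k * c') (|k| * l') with hS
  have hQ := preimage_affine_cube c c' l' hk
  have ha : ENNReal.ofReal |k⁻¹| ≠ 0 := by simpa using hk
  rw [← hQ, ← hT.map_apply, Measure.map_smul, ← hT.restrict_map, map_affine_volume c hk,
    Measure.restrict_smul, smul_smul, Measure.smul_apply, smul_eq_mul,
    ENNReal.mul_inv (Or.inl ha) (Or.inl ENNReal.ofReal_ne_top), mul_right_comm,
    ENNReal.inv_mul_cancel ha ENNReal.ofReal_ne_top, one_mul]

theorem setAverage_comp_affine (f : ℝ → ℝ) (c c' l' : ℝ) {k : ℝ} (hk : k ≠ 0) :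
    ⨍ y in cube c' l', f (c + k * y) = ⨍ z in cube (c + k * c') (|k| * l'), f z := by
  rw [setAverage_eq', setAverage_eq', ← map_affine_cond_cube c c' l' hk,
    (measurableEmbedding_affine c hk).integral_map]

theorem osc_comp_affine (f : ℝ → ℝ) (c c' l' : ℝ) {k : ℝ} (hk : k ≠ 0) :
    osc (fun y => f (c + k * y)) (cube c' l') = osc f (cube (c + k * c') (|k| * l')) := by
  rw [osc, osc, setAverage_comp_affine f c c' l' hk, setLAverage_eq', setLAverage_eq',
    ← map_affine_cond_cube c c' l' hk, (measurableEmbedding_affine c hk).lintegral_map]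

theorem integrableOn_comp_affine {f : ℝ → ℝ} (c c' l' : ℝ) {k : ℝ} (hk : k ≠ 0)
    (hf : IntegrableOn f (cube (c + k * c') (|k| * l'))) :
    IntegrableOn (fun y => f (c + k * y)) (cube c' l') := by
  rw [← preimage_affine_cube c c' l' hk]
  refine ((measurableEmbedding_affine c hk).integrableOn_map_iff (f := f)).1 ?_
  rw [map_affine_volume c hk, IntegrableOn, Measure.restrict_smul]
  exact hf.smul_measure ENNReal.ofReal_ne_top

theorem setAverage_sub_div {g : ℝ → ℝ} {c l : ℝ} (hl : 0 < l) (hg : IntegrableOn g (cube c l))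
    (A M : ℝ) :
    ⨍ y in cube c l, (g y - A) / M = ((⨍ y in cube c l, g y) - A) / M := by
  have hc : ⨍ _ in cube c l, A ∂volume = A :=
    setAverage_const (volume_cube_ne_zero hl) (volume_cube_ne_top c l) A
  rw [setAverage_eq] at hc ⊢
  rw [setAverage_eq, integral_div, integral_sub hg (integrableOn_const (volume_cube_ne_top c l))]
  conv_rhs => rw [← hc]
  simp only [smul_eq_mul]
  ring

theorem osc_sub_div {g : ℝ → ℝ} {c l : ℝ} (hl : 0 < l) (hg : IntegrableOn g (cube c l)) (A : ℝ)
    {M : ℝ≥0∞} (hM : M ≠ 0) (hM' : M ≠ ∞) :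
    osc (fun y => (g y - A) / M.toReal) (cube c l) = osc g (cube c l) / M := by
  have hMpos : 0 < M.toReal := ENNReal.toReal_pos hM hM'
  have h1 : ∀ y, ‖(g y - A) / M.toReal - ((⨍ y in cube c l, g y) - A) / M.toReal‖ₑ
      = M⁻¹ * ‖g y - ⨍ y in cube c l, g y‖ₑ := by
    intro y
    rw [← sub_div, sub_sub_sub_cancel_right, div_eq_inv_mul, enorm_mul]
    congr 1
    rw [Real.enorm_of_nonneg (inv_nonneg.2 hMpos.le), ENNReal.ofReal_inv_of_pos hMpos,
      ENNReal.ofReal_toReal hM']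
  rw [osc, setAverage_sub_div hl hg]
  simp only [h1]
  rw [osc, setLAverage_eq, setLAverage_eq, lintegral_const_mul' _ _ (ENNReal.inv_ne_top.2 hM)]
  simp only [div_eq_mul_inv]
  ring

/-- The factor `2` arises because replacing `u` by `v` changes both the integrand and the subtracted
mean. -/
theorem osc_le_osc_add {u v : ℝ → ℝ} {c l : ℝ}
    (hu : IntegrableOn u (cube c l)) (hv : IntegrableOn v (cube c l)) :
    osc u (cube c l) ≤ osc v (cube c l) + 2 * ((∫⁻ y in cube c l, ‖u y - v y‖ₑ)
      / volume (cube c l)) := by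
  set Q := cube c l with hQ
  set U := ⨍ y in Q, u y with hU
  set V := ⨍ y in Q, v y with hV
  set D := (∫⁻ y in Q, ‖u y - v y‖ₑ) / volume Q with hD
  have hvQ : volume Q ≠ ∞ := volume_cube_ne_top c l
  have hVU : ‖V - U‖ₑ ≤ D := by
    have e : U - V = ∫ y, (u y - v y) ∂((volume Q)⁻¹ • volume.restrict Q) := by
      rw [hU, hV, setAverage_eq', setAverage_eq', integral_sub]
      · simpa only [Measure.restrict_apply_univ] using Integrable.to_average hu
      · simpa only [Measure.restrict_apply_univ] using Integrable.to_average hv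
    rw [← enorm_neg, neg_sub, e]
    refine (enorm_integral_le_lintegral_enorm _).trans_eq ?_
    rw [lintegral_smul_measure, hD, div_eq_mul_inv, mul_comm, smul_eq_mul]
  rw [osc, osc, setLAverage_eq, setLAverage_eq, ← hU, ← hV]
  have h1 : AEMeasurable (fun y => ‖u y - v y‖ₑ) (volume.restrict Q) :=
    (hu.aestronglyMeasurable.sub hv.aestronglyMeasurable).enorm
  have h2 : AEMeasurable (fun y => ‖v y - V‖ₑ) (volume.restrict Q) :=
    (hv.aestronglyMeasurable.sub aestronglyMeasurable_const).enorm
  calc (∫⁻ y in Q, ‖u y - U‖ₑ) / volume Q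
      ≤ (∫⁻ y in Q, (‖u y - v y‖ₑ + (‖v y - V‖ₑ + D))) / volume Q := by
        gcongr with y
        calc ‖u y - U‖ₑ = ‖(u y - v y) + ((v y - V) + (V - U))‖ₑ := by congr 1; ring
          _ ≤ ‖u y - v y‖ₑ + ‖(v y - V) + (V - U)‖ₑ := enorm_add_le _ _
          _ ≤ _ := by gcongr; exact (enorm_add_le _ _).trans (by gcongr)
    _ = D + (∫⁻ y in Q, ‖v y - V‖ₑ) / volume Q + D * (volume Q / volume Q) := by
        rw [lintegral_add_left' h1, lintegral_add_left' h2, setLIntegral_const, ENNReal.add_div,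
          ENNReal.add_div, mul_div_assoc, add_assoc]
    _ ≤ D + (∫⁻ y in Q, ‖v y - V‖ₑ) / volume Q + D * 1 := by
        gcongr; exact ENNReal.div_self_le_one
    _ = _ := by ring

theorem tendsto_osc {u : ℝ → ℝ} {v : ℕ → ℝ → ℝ} (hu : IntegrableOn u unitCube)
    (hv : ∀ᶠ j in atTop, IntegrableOn (v j) unitCube)
    (h : Tendsto (fun j => ∫⁻ y in unitCube, ‖v j y - u y‖ₑ) atTop (𝓝 0))
    {c l : ℝ} (hl : 0 < l) (hQ : cube c l ⊆ unitCube) :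
    Tendsto (fun j => osc (v j) (cube c l)) atTop (𝓝 (osc u (cube c l))) := by
  set D : ℕ → ℝ≥0∞ := fun j => 2 * ((∫⁻ y in unitCube, ‖v j y - u y‖ₑ) / volume (cube c l))
  have hD : Tendsto D atTop (𝓝 0) := by
    have h1 := ENNReal.Tendsto.div_const h (b := volume (cube c l)) (Or.inr (volume_cube_ne_zero hl))
    have h2 := ENNReal.Tendsto.const_mul h1 (a := 2) (Or.inr (by simp))
    simpa using h2
  have hup : Tendsto (fun j => osc u (cube c l) + D j) atTop (𝓝 (osc u (cube c l))) := by
    simpa using hD.const_add (osc u (cube c l))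
  have hlow : Tendsto (fun j => osc u (cube c l) - D j) atTop (𝓝 (osc u (cube c l))) := by
    simpa using ENNReal.Tendsto.sub (tendsto_const_nhds (x := osc u (cube c l))) hD
      (Or.inr (by simp))
  refine tendsto_of_tendsto_of_tendsto_of_le_of_le' hlow hup ?_ ?_
  · filter_upwards [hv] with j hj
    rw [tsub_le_iff_right]
    refine (osc_le_osc_add (hu.mono_set hQ) (hj.mono_set hQ)).trans ?_
    simp only [enorm_sub_rev (u _), D]
    gcongr
  · filter_upwards [hv] with j hj
    refine (osc_le_osc_add (hj.mono_set hQ) (hu.mono_set hQ)).trans ?_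
    simp only [D]
    gcongr

/-! ### Short intervals in `I` and sublevel sets of the Poincaré supremum -/

/-- The closed interval matters: compactness in `I` yields finite variation and integrability of
`f`. -/
theorem exists_pos_Icc_subset {I : Set ℝ} (hI : IsOpen I) {x : ℝ} (hx : x ∈ I) :
    ∃ r > 0, ∀ c l : ℝ, l ≤ r → x ∈ cube c l → Icc (c - l / 2) (c + l / 2) ⊆ I := by
  obtain ⟨r, hr, hrI⟩ := Metric.isOpen_iff.1 hI x hx
  refine ⟨r, hr, fun c l hl hxc y hy => hrI ?_⟩
  have h1 := hxc.1
  have h2 := hxc.2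
  rw [Metric.mem_ball, Real.dist_eq, abs_lt]
  constructor <;> linarith [hy.1, hy.2]

theorem cube_subset_of_Icc_subset {I : Set ℝ} {c l : ℝ}
    (h : Icc (c - l / 2) (c + l / 2) ⊆ I) : cube c l ⊆ I :=
  Ioo_subset_Icc_self.trans h

theorem Icc_subset_of_cube_subset {I : Set ℝ} {c l c' l' : ℝ} (hl' : 0 < l')
    (h : cube c' l' ⊆ cube c l) (hI : Icc (c - l / 2) (c + l / 2) ⊆ I) :
    Icc (c' - l' / 2) (c' + l' / 2) ⊆ I := by
  refine Subset.trans ?_ hI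
  rw [← closure_Ioo (by linarith : c' - l' / 2 ≠ c' + l' / 2)]
  exact closure_minimal (h.trans Ioo_subset_Icc_self) isClosed_Icc

theorem pos_variation_cube {I : Set ℝ} {f : ℝ → ℝ} {x c l : ℝ} (hx : x ∈ spt I f)
    (hxc : x ∈ cube c l) : 0 < variation I f (cube c l) :=
  (Measure.mem_support_iff_forall x).1 hx.1 _ ((isOpen_cube c l).mem_nhds hxc)

/-- An interval whose quotient exceeds `b` at one of its points does so for all of them, so the
complement is open. -/
theorem isClosed_poincareSup_le (I : Set ℝ) (f : ℝ → ℝ) (ε : ℝ) (b : ℝ≥0∞) :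
    IsClosed {x | poincareSup I f x ε ≤ b} := by
  rw [← isOpen_compl_iff, isOpen_iff_mem_nhds]
  intro x hx
  simp only [mem_compl_iff, mem_ofPred_eq, not_le, poincareSup, lt_iSup_iff] at hx
  obtain ⟨c, l, ⟨hl, hlε, hI, hxc⟩, hb⟩ := hx
  filter_upwards [(isOpen_cube c l).mem_nhds hxc] with y hy
  simp only [mem_compl_iff, mem_ofPred_eq, not_le, poincareSup, lt_iSup_iff]
  exact ⟨c, l, ⟨hl, hlε, hI, hy⟩, hb⟩

theorem poincareConst_le_poincareSup {I : Set ℝ} {f : ℝ → ℝ} {x ε : ℝ} (hx : x ∈ spt I f)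
    (hε : 0 < ε) : poincareConst I f x ≤ poincareSup I f x ε := by
  refine le_of_tendsto (tendsto_poincareSup I f x hx) ?_
  filter_upwards [Ioc_mem_nhdsGT hε] with δ hδ
  exact poincareSup_mono I f x hδ.2

variable {I : Set ℝ} {f σ : ℝ → ℝ}

theorem IsPolarDeriv.osc_cube_le (h : IsPolarDeriv I f (variation I f) σ)
    (hf : LocallyIntegrableOn f I) {c l : ℝ} (hl : 0 < l)
    (hI : Icc (c - l / 2) (c + l / 2) ⊆ I) :
    osc f (cube c l) ≤ variation I f (cube c l) :=
  h.osc_le hf (by linarith) hI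

theorem IsPolarDeriv.variation_cube_lt_top (h : IsPolarDeriv I f (variation I f) σ) {c l : ℝ}
    (hI : Icc (c - l / 2) (c + l / 2) ⊆ I) : variation I f (cube c l) < ∞ :=
  (measure_mono Ioo_subset_Icc_self).trans_lt (h.compact_lt_top _ isCompact_Icc hI)

theorem integrableOn_cube (hf : LocallyIntegrableOn f I) {c l : ℝ}
    (hI : Icc (c - l / 2) (c + l / 2) ⊆ I) : IntegrableOn f (cube c l) :=
  (hf.integrableOn_compact_subset hI isCompact_Icc).mono_set Ioo_subset_Icc_self

/-! ### Rescalings on oriented cubes -/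

theorem abs_orientation_mul (s : ℤˣ) {l : ℝ} (hl : 0 < l) : |((s : ℤ) : ℝ) * l| = l := by
  rcases Int.units_eq_one_or s with rfl | rfl <;> simp [abs_of_pos hl]

theorem orientation_mul_ne_zero (s : ℤˣ) {l : ℝ} (hl : 0 < l) : ((s : ℤ) : ℝ) * l ≠ 0 := by
  rw [← abs_pos, abs_orientation_mul s hl]; exact hl

theorem integrableOn_comp_orientation {c l : ℝ} (s : ℤˣ) (hl : 0 < l)
    (hf : IntegrableOn f (cube c l)) :
    IntegrableOn (fun y => f (c + ((s : ℤ) : ℝ) * l * y)) unitCube := by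
  rw [unitCube_eq_cube]
  refine integrableOn_comp_affine c 0 1 (orientation_mul_ne_zero s hl) ?_
  simpa [abs_orientation_mul s hl] using hf

theorem integrableOn_rescale {c l : ℝ} (s : ℤˣ) (hl : 0 < l) (hf : IntegrableOn f (cube c l)) :
    IntegrableOn (rescale I f c l s) unitCube :=
  ((integrableOn_comp_orientation s hl hf).sub (integrableOn_const (by
    rw [unitCube_eq_cube]; exact volume_cube_ne_top _ _))).div_const _

theorem setAverage_rescale {c l : ℝ} (s : ℤˣ) (hl : 0 < l) (hf : IntegrableOn f (cube c l)) :
    ⨍ y in unitCube, rescale I f c l s y = 0 := by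
  have hi := integrableOn_comp_orientation s hl hf
  rw [unitCube_eq_cube] at hi ⊢
  simp only [rescale]
  rw [setAverage_sub_div one_pos hi,
    setAverage_comp_affine f c 0 1 (orientation_mul_ne_zero s hl), abs_orientation_mul s hl]
  simp

theorem osc_rescale {c l : ℝ} (s : ℤˣ) (hl : 0 < l) (hf : IntegrableOn f (cube c l))
    (h0 : variation I f (cube c l) ≠ 0) (htop : variation I f (cube c l) ≠ ∞) {c' l' : ℝ}
    (hl' : 0 < l') (hQ : cube c' l' ⊆ unitCube) :
    osc (rescale I f c l s) (cube c' l') =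
      osc f (cube (c + ((s : ℤ) : ℝ) * l * c') (l * l')) / variation I f (cube c l) := by
  have hi := (integrableOn_comp_orientation s hl hf).mono_set hQ
  have h1 := osc_sub_div hl' hi (⨍ z in cube c l, f z) h0 htop
  rw [osc_comp_affine f c c' l' (orientation_mul_ne_zero s hl), abs_orientation_mul s hl] at h1
  exact h1

/-! ### Tangents attain the Poincaré constant -/

/-- Every value below the local Poincaré constant is exceeded by the oscillation of a tangent. -/
theorem IsPolarDeriv.exists_mem_tan (hI : IsOpen I) (h : IsPolarDeriv I f (variation I f) σ)
    (hf : LocallyIntegrableOn f I) {x : ℝ} (hx : x ∈ spt I f) {b : ℝ≥0∞}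
    (hb : b < poincareConst I f x) : ∃ u ∈ tan I f x, b ≤ osc u unitCube := by
  obtain ⟨r, hr, hrI⟩ := exists_pos_Icc_subset hI hx.2
  have hex : ∀ j : ℕ, ∃ c l : ℝ, (0 < l ∧ l ≤ min r (1 / (j + 1)) ∧ cube c l ⊆ I ∧ x ∈ cube c l)
      ∧ b < poincareQuotient I f (cube c l) := by
    intro j
    have := hb.trans_le (poincareConst_le_poincareSup hx
      (lt_min hr (by positivity : (0 : ℝ) < 1 / (j + 1))))
    simpa only [poincareSup, lt_iSup_iff, exists_prop] using this
  choose c l hcl hbj using hex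
  have hl : ∀ j, 0 < l j := fun j => (hcl j).1
  have hxc : ∀ j, x ∈ cube (c j) (l j) := fun j => (hcl j).2.2.2
  have hIcc : ∀ j, Icc (c j - l j / 2) (c j + l j / 2) ⊆ I := fun j =>
    hrI _ _ ((hcl j).2.1.trans (min_le_left _ _)) (hxc j)
  have h0 : ∀ j, variation I f (cube (c j) (l j)) ≠ 0 := fun j =>
    (pos_variation_cube hx (hxc j)).ne'
  have htop : ∀ j, variation I f (cube (c j) (l j)) ≠ ∞ := fun j =>
    (h.variation_cube_lt_top (hIcc j)).ne
  have hfi : ∀ j, IntegrableOn f (cube (c j) (l j)) := fun j => integrableOn_cube hf (hIcc j)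
  have hlim : Tendsto l atTop (𝓝 0) :=
    squeeze_zero (fun j => (hl j).le) (fun j => (hcl j).2.1.trans (min_le_right _ _))
      tendsto_one_div_add_atTop_nhds_zero_nat
  have hmeas : ∀ j, Measurable fun z => (l j)⁻¹ * (z - c j) := fun j =>
    (measurable_id.sub_const _).const_mul _
  -- The measure controlling the rescaled function is `|Df|` pulled to unit scale and divided by its
  -- mass on the cube.
  have hm : ∀ j c' l', ((variation I f (cube (c j) (l j)))⁻¹ •
      (variation I f).map fun z => (l j)⁻¹ * (z - c j)) (cube c' l') =
      variation I f (cube (c j + l j * c') (l j * l')) / variation I f (cube (c j) (l j)) := by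
    intro j c' l'
    rw [Measure.smul_apply, Measure.map_apply (hmeas j) (isOpen_cube _ _).measurableSet,
      preimage_affine_symm_cube _ _ _ (hl j).ne', abs_of_pos (hl j), smul_eq_mul, div_eq_mul_inv,
      mul_comm]
  obtain ⟨u, hu, φ, hφ, hlimu⟩ := exists_subseq_tendsto_unitCube
    (v := fun j => rescale I f (c j) (l j) 1)
    (fun j => integrableOn_rescale 1 (hl j) (hfi j))
    (m := fun j => (variation I f (cube (c j) (l j)))⁻¹ •
      (variation I f).map fun z => (l j)⁻¹ * (z - c j))
    (fun j => by
      rw [unitCube_eq_cube, hm]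
      simp [ENNReal.div_self_le_one])
    (fun j a b hab hsub => by
      have e : Ioo a b = cube ((a + b) / 2) (b - a) := by
        simp only [cube]; congr 1 <;> ring
      rw [e] at hsub ⊢
      have hba : 0 < b - a := sub_pos.2 hab
      have hsub' := affine_cube_subset (c := c j) (hl j).ne' hsub
      rw [abs_of_pos (hl j)] at hsub'
      rw [hm, osc_rescale 1 (hl j) (hfi j) (h0 j) (htop j) hba hsub]
      simp only [Units.val_one, Int.cast_one, one_mul]
      gcongr
      exact h.osc_cube_le hf (mul_pos (hl j) hba)
        (Icc_subset_of_cube_subset (mul_pos (hl j) hba) hsub' (hIcc j)))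
    (fun j => setAverage_rescale 1 (hl j) (hfi j))
  refine ⟨u, ⟨hx, hu, c ∘ φ, l ∘ φ, fun _ => 1, fun j => ⟨hl _, (hcl _).2.2.1, hxc _⟩,
    hlim.comp hφ.tendsto_atTop, hlimu⟩, ?_⟩
  have hosc := tendsto_osc hu
    (Eventually.of_forall fun j => integrableOn_rescale 1 (hl (φ j)) (hfi (φ j))) hlimu one_pos
    unitCube_eq_cube.ge
  rw [← unitCube_eq_cube] at hosc
  refine ge_of_tendsto' hosc fun j => ?_
  have h1 := osc_rescale 1 (hl (φ j)) (hfi (φ j)) (h0 (φ j)) (htop (φ j)) one_pos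
    unitCube_eq_cube.ge
  rw [← unitCube_eq_cube] at h1
  simp only [mul_zero, add_zero, mul_one] at h1
  rw [h1]
  exact (hbj (φ j)).le

/-! ### Almost every point bounds its tangents -/

theorem IsPolarDeriv.measure_porous_points_inter_eq_zero (hI : IsOpen I)
    (h : IsPolarDeriv I f (variation I f) σ) {F : Set ℝ} (hF : IsClosed F) {δ : ℝ≥0∞}
    (hδ : δ ≠ 0) :
    variation I f {x ∈ F ∩ I | ∀ ε > 0, ∃ a b : ℝ, b - a < ε ∧ x ∈ Ioo a b ∧
      δ * variation I f (Ioo a b) ≤ variation I f (Ioo a b \ F)} = 0 := by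
  set μ := variation I f with hμ
  refine measure_null_of_locally_null _ fun x hx => ?_
  obtain ⟨r, hr, hrI⟩ := exists_pos_Icc_subset hI hx.1.2
  have hxr : x ∈ cube x r := by constructor <;> linarith
  set J := cube x r with hJ
  have hfin : IsFiniteMeasure (μ.restrict J) := ⟨by
    rw [Measure.restrict_apply_univ]; exact h.variation_cube_lt_top (hrI x r le_rfl hxr)⟩
  refine ⟨_, inter_mem self_mem_nhdsWithin
    (mem_nhdsWithin_of_mem_nhds ((isOpen_cube x r).mem_nhds hxr)), ?_⟩
  have hnull := measure_porous_points_eq_zero (μ.restrict J) hF hδ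
  refine measure_mono_null ?_ (le_antisymm ((Measure.le_restrict_apply J _).trans hnull.le) bot_le)
  rintro y ⟨⟨hyF, hy⟩, hyJ⟩
  refine ⟨⟨hyF.1, fun ε hε => ?_⟩, hyJ⟩
  obtain ⟨r', hr', hr'J⟩ := exists_pos_Icc_subset (isOpen_cube x r) hyJ
  -- Lengths below `r'` keep the interval inside `J`, where the restricted finite measure agrees
  -- with `|Df|`.
  obtain ⟨a, b, hab, hyab, hle⟩ := hy (min ε r') (lt_min hε hr')
  have e : Ioo a b = cube ((a + b) / 2) (b - a) := by
    simp only [cube]; congr 1 <;> ring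
  have hsub : Ioo a b ⊆ J := by
    rw [e] at hyab ⊢
    exact cube_subset_of_Icc_subset (hr'J _ _ (hab.le.trans (min_le_right _ _)) hyab)
  refine ⟨a, b, hab.trans_le (min_le_left _ _), hyab, ?_⟩
  rwa [Measure.restrict_eq_self _ hsub, Measure.restrict_eq_self _ (sdiff_subset.trans hsub)]

/-- A point at which some tangent has larger mean oscillation than the local Poincaré constant
is a porous point of a sublevel set of `poincareSup`. -/
theorem IsPolarDeriv.porous_of_lt_osc (hI : IsOpen I) (h : IsPolarDeriv I f (variation I f) σ)
    (hf : LocallyIntegrableOn f I) {x : ℝ} {u : ℝ → ℝ} (hu : u ∈ tan I f x) {c' l' : ℝ}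
    (hl' : 0 < l') (hQ : cube c' l' ⊆ unitCube) {q : ℝ≥0∞} (hq : q < osc u (cube c' l'))
    {η : ℝ} (hη : 0 < η) :
    ∀ ε > 0, ∃ a b : ℝ, b - a < ε ∧ x ∈ Ioo a b ∧ q * variation I f (Ioo a b) ≤
      variation I f (Ioo a b \ {y | poincareSup I f y η ≤ q}) := by
  intro ε hε
  obtain ⟨hx, hui, c, l, s, hcl, hlim, hL1⟩ := hu
  obtain ⟨r, hr, hrI⟩ := exists_pos_Icc_subset hI hx.2
  have hlr : ∀ᶠ j in atTop, l j ≤ r := hlim.eventually (ge_mem_nhds hr)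
  have hfi : ∀ᶠ j in atTop, IntegrableOn f (cube (c j) (l j)) := by
    filter_upwards [hlr] with j hj using integrableOn_cube hf (hrI _ _ hj (hcl j).2.2)
  have hosc := tendsto_osc hui (by
    filter_upwards [hfi] with j hj using integrableOn_rescale (s j) (hcl j).1 hj) hL1 hl' hQ
  obtain ⟨j, hjr, hjε, hjη, hjf, hjq⟩ := (hlr.and ((hlim.eventually (gt_mem_nhds hε)).and
    ((hlim.eventually (ge_mem_nhds hη)).and
      (hfi.and (hosc.eventually (lt_mem_nhds hq)))))).exists
  obtain ⟨hl, hcI, hxc⟩ := hcl j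
  have hIcc := hrI _ _ hjr hxc
  have h0 := (pos_variation_cube hx hxc).ne'
  have htop := (h.variation_cube_lt_top hIcc).ne
  rw [osc_rescale (s j) hl hjf h0 htop hl' hQ, ENNReal.lt_div_iff_mul_lt (Or.inl h0)
    (Or.inl htop)] at hjq
  have hsub := affine_cube_subset (c := c j) (orientation_mul_ne_zero (s j) hl) hQ
  rw [abs_orientation_mul (s j) hl] at hsub
  set R := cube (c j + ((s j : ℤ) : ℝ) * l j * c') (l j * l') with hR
  have hll : 0 < l j * l' := mul_pos hl hl'
  have hRIcc := Icc_subset_of_cube_subset hll hsub hIcc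
  have hRosc : osc f R ≤ variation I f R := h.osc_cube_le hf hll hRIcc
  -- A point of `F` in `R` would force `Osc(f,R) ≤ q |Df|(R) ≤ q |Df|(Q_j)`, contradicting the
  -- choice of `j`. If `|Df|(R) = 0`, the Poincaré inequality gives zero oscillation directly.
  have hdisj : R ∩ {y | poincareSup I f y η ≤ q} = ∅ := by
    refine eq_empty_of_forall_notMem fun y hy => hjq.not_ge ?_
    have h1 : poincareQuotient I f R ≤ q := by
      refine le_trans ?_ hy.2
      refine le_iSup₂_of_le (c j + ((s j : ℤ) : ℝ) * l j * c') (l j * l') (le_iSup_of_le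
        ⟨hll, (le_of_cube_subset_cube hl.le hsub).trans hjη, hsub.trans hcI, hy.1⟩ le_rfl)
    have h2 : osc f R ≤ q * variation I f R := by
      rcases eq_or_ne (variation I f R) 0 with hR0 | hR0
      · rw [hR0] at hRosc
        exact hRosc.trans bot_le
      · exact (ENNReal.div_le_iff hR0 (h.variation_cube_lt_top hRIcc).ne).1 h1
    exact h2.trans (by gcongr)
  refine ⟨c j - l j / 2, c j + l j / 2, by linarith, hxc, ?_⟩
  refine (hjq.le.trans hRosc).trans (measure_mono fun y hy => ⟨hsub hy, fun hyF => ?_⟩)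
  exact eq_empty_iff_forall_notMem.1 hdisj y ⟨hy, hyF⟩

theorem IsPolarDeriv.ae_bmo_tan_le (hI : IsOpen I) (h : IsPolarDeriv I f (variation I f) σ)
    (hf : LocallyIntegrableOn f I) :
    ∀ᵐ x ∂(variation I f), ∀ u ∈ tan I f x, bmo u unitCube ≤ poincareConst I f x := by
  -- The exceptional set must be fixed before the tangent, hence scales `1/(n+1)` and rational
  -- levels only.
  have hnull : ∀ᵐ x ∂(variation I f), ∀ (n : ℕ) (q : ℚ), (Real.toNNReal q : ℝ≥0∞) ≠ 0 →
      x ∉ {x ∈ {y | poincareSup I f y (1 / (n + 1)) ≤ (Real.toNNReal q : ℝ≥0∞)} ∩ I |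
        ∀ ε > 0, ∃ a b : ℝ, b - a < ε ∧ x ∈ Ioo a b ∧
          (Real.toNNReal q : ℝ≥0∞) * variation I f (Ioo a b) ≤ variation I f (Ioo a b \
            {y | poincareSup I f y (1 / (n + 1)) ≤ (Real.toNNReal q : ℝ≥0∞)})} := by
    refine ae_all_iff.2 fun n => ae_all_iff.2 fun q => ?_
    by_cases hq : (Real.toNNReal q : ℝ≥0∞) = 0
    · exact Eventually.of_forall fun x hx => absurd hq hx
    · filter_upwards [measure_eq_zero_iff_ae_notMem.1 (h.measure_porous_points_inter_eq_zero hI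
        (isClosed_poincareSup_le I f (1 / (n + 1)) (Real.toNNReal q)) hq)] with x hx _ using hx
  filter_upwards [hnull] with x hx u hu
  refine iSup₂_le fun c' l' => iSup_le fun hQ => ?_
  by_contra! hlt
  obtain ⟨q, -, hpq, hqo⟩ := ENNReal.lt_iff_exists_rat_btwn.1 hlt
  have hev : ∀ᶠ n : ℕ in atTop, poincareSup I f x (1 / (n + 1)) < (Real.toNNReal q : ℝ≥0∞) := by
    have h1 : Tendsto (fun n : ℕ => (1 : ℝ) / (n + 1)) atTop (𝓝[>] 0) :=
      tendsto_nhdsWithin_iff.2 ⟨tendsto_one_div_add_atTop_nhds_zero_nat,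
        Eventually.of_forall fun n => by simp only [mem_Ioi]; positivity⟩
    exact ((tendsto_poincareSup I f x hu.1).comp h1).eventually (gt_mem_nhds hpq)
  obtain ⟨n, hn⟩ := hev.exists
  exact hx n q (bot_le.trans_lt hpq).ne' ⟨⟨hn.le, hu.1.2⟩,
    h.porous_of_lt_osc hI hf hu hQ.1 hQ.2 hqo (by positivity)⟩

end BVLine

theorem corollary1p5 (I : Set ℝ) (hI : IsOpen I) (hIconn : I.OrdConnected) (f : ℝ → ℝ)
    (hf : BVLine.BVLoc I f) :
    ∀ᵐ x ∂(BVLine.variation I f),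
      BVLine.poincareConst I f x = ⨆ u ∈ BVLine.tan I f x, BVLine.bmo u BVLine.unitCube := by
  obtain ⟨hfl, μ, σ, hμ⟩ := hf
  have h := hμ
  rw [← BVLine.variation_eq hI hμ] at h
  filter_upwards [h.ae_bmo_tan_le hI hfl] with x hx
  refine le_antisymm ?_ (iSup₂_le hx)
  by_cases hxs : x ∈ BVLine.spt I f
  · refine le_of_forall_lt fun b hb => ?_
    obtain ⟨b', hbb', hb'⟩ := exists_between hb
    obtain ⟨u, hu, hbu⟩ := h.exists_mem_tan hI hfl hxs hb'
    refine hbb'.trans_le (hbu.trans ?_)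
    refine le_trans ?_ (le_iSup₂ (f := fun u _ => BVLine.bmo u BVLine.unitCube) u hu)
    -- The whole unit cube is itself a competitor in the BMO supremum.
    refine le_trans ?_ (le_iSup₂_of_le 0 1 (le_iSup_of_le
      ⟨one_pos, BVLine.unitCube_eq_cube.ge⟩ le_rfl))
    rw [BVLine.unitCube_eq_cube]
  · rw [BVLine.poincareConst, if_neg hxs]
    exact bot_le
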